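/- Let $k$ be a field, let $W$ be a finite group, and let $P$ be a locally finite poset on which $W$ acts by order-preserving maps. For $x\le y$ in $P$ let $W_{xy}=W_x\cap W_y$ be the common stabilizer, and let $\operatorname{VRep}(W_{xy})$ be the Grothendieck group of finite-dimensional representations of $W_{xy}$ over $k$. Let $\{r_{xy}\in\mathbb N\mid x\le y\}$ be a $W$-invariant weak rank function: $r_{xy}>0$ if $x<y$, $r_{xy}+r_{yz}=r_{xz}$ if $x\le y\le z$, and $r_{\sigma(x)\sigma(y)}=r_{xy}$ for $\sigma\in W$. Let $\mathcal C^W(P)$ be the category whose objects $V$ consist of finite-dimensional $k$-vector spaces $V_{xy}$ ($x\le y$ in $P$) and linear maps $\varphi^\sigma_{xy}:V_{xy}\to V_{\sigma(x)\sigma(y)}$ ($\sigma\in W$) with $\varphi^e_{xy}=\operatorname{id}$ and $\varphi^{\sigma'}_{\sigma(x)\sigma(y)}\circ\varphi^{\sigma}_{xy}=\varphi^{\sigma'\sigma}_{xy}$; morphisms are families of linear maps commuting with the $\varphi^\sigma$. The tensor product is $(U\otimes V)_{xz}=\bigoplus_{x\le y\le z}U_{xy}\otimes V_{yz}$. Let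 $I^W(P)$ be the Grothendieck ring of $\mathcal C^W(P)$, with unit $\delta$; an element $f$ of it has components $f_{xy}\in\operatorname{VRep}(W_{xy})$, where $[V]_{xy}=[V_{xy}]$, and is determined by them. Let $\mathscr I^W(P)$ be the ring of formal sums $f=\sum_{n\ge 0}f_nt^n$ with $f_n\in I^W(P)$ such that, for all $x\le y$, $f_{xy}(t)=\sum_n (f_n)_{xy}t^n$ is a polynomial of degree at most $r_{xy}$. Let $f\mapsto\bar f$ be the involution of $\mathscr I^W(P)$ given by $\bar f_{xy}(t)=t^{r_{xy}}f_{xy}(t^{-1})$. Let $\mathscr I^W_{1/2}(P)\subset\mathscr I^W(P)$ be the set of those $f$ with $\deg f_{xy}(t)<r_{xy}/2$ for all $x<y$ and $f_{xx}(t)=\delta_{xx}$ for all $x$. An element $\kappa\in\mathscr I^W(P)$ is a $P$-kernel if $\kappa_{xx}(t)=\delta_{xx}$ for all $x$ and $\bar\kappa=\kappa^{-1}$. Its right and left equivariant KLS-functions are the elements $f,g\in\mathscr I^W_{1/2}(P)$ with $\bar f=\kappa f$ and $\bar g=g\kappa$. **Proposition.** Let $\kappa\in\mathscr I^W(P)$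 be a $P$-kernel with right equivariant KLS-function $f$ and left equivariant KLS-function $g$, and let $Z=g\kappa f$ be the equivariant $Z$-function associated with $\kappa$. Then $Z\in\mathscr I^W(P)$ and $\bar Z=Z$; that is, $t^{r_{xy}}Z_{xy}(t^{-1})=Z_{xy}(t)$ for all $x\le y$ in $P$. -/

import Mathlib

open scoped TensorProduct DirectSum

universe u v

noncomputable section

/-! ### Grothendieck groups -/

/-- The Grothendieck group of a collection `C` of objects with a notion `ses A B D` of
"there is a short exact sequence `0 → A → B → D → 0`": the free abelian group on `C` modulo the
relations `[B] = [A] + [D]`. -/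
def GrothendieckGroup {C : Type*} (ses : C → C → C → Prop) : Type _ :=
  FreeAbelianGroup C ⧸ AddSubgroup.closure
    {a : FreeAbelianGroup C | ∃ A B D, ses A B D ∧
      a = FreeAbelianGroup.of B - FreeAbelianGroup.of A - FreeAbelianGroup.of D}

namespace GrothendieckGroup

variable {C : Type*} {ses : C → C → C → Prop}

instance : AddCommGroup (GrothendieckGroup ses) :=
  inferInstanceAs (AddCommGroup (FreeAbelianGroup C ⧸ AddSubgroup.closure _))

/-- The class `[A]` of an object. -/
def mk (ses : C → C → C → Prop) (A : C) : GrothendieckGroup ses :=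
  QuotientAddGroup.mk (FreeAbelianGroup.of A)

theorem mk_ses {A B D : C} (h : ses A B D) : mk ses B = mk ses A + mk ses D := by
  have : (QuotientAddGroup.mk (FreeAbelianGroup.of B - FreeAbelianGroup.of A -
      FreeAbelianGroup.of D) : GrothendieckGroup ses) = 0 :=
    (QuotientAddGroup.eq_zero_iff _).2 (AddSubgroup.subset_closure ⟨A, B, D, h, rfl⟩)
  have h2 : mk ses B - mk ses A - mk ses D = 0 := this
  rw [sub_sub, sub_eq_zero] at h2
  exact h2

/-- A function on objects that is additive on short exact sequences extends to the
Grothendieck group. -/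
def lift {G : Type*} [AddCommGroup G] (φ : C → G)
    (h : ∀ A B D, ses A B D → φ B = φ A + φ D) : GrothendieckGroup ses →+ G :=
  QuotientAddGroup.lift _ (FreeAbelianGroup.lift φ) (by
    rw [AddSubgroup.closure_le]
    rintro _ ⟨A, B, D, hs, rfl⟩
    simp [h A B D hs])

@[simp] theorem lift_mk {G : Type*} [AddCommGroup G] (φ : C → G)
    (h : ∀ A B D, ses A B D → φ B = φ A + φ D) (A : C) : lift φ h (mk ses A) = φ A :=
  FreeAbelianGroup.lift_apply_of φ A

theorem hom_ext {G : Type*} [AddCommGroup G] {φ ψ : GrothendieckGroup ses →+ G}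
    (h : ∀ A, φ (mk ses A) = ψ (mk ses A)) : φ = ψ :=
  QuotientAddGroup.addMonoidHom_ext _ (FreeAbelianGroup.lift_ext _ _ h)

end GrothendieckGroup

/-! ### Virtual representations -/

/-- Existence of a short exact sequence `0 → A → B → D → 0` of finite dimensional
representations of `G` over `k`. -/
def FDRep.SES {k : Type u} [Field k] {G : Type v} [Group G] (A B D : FDRep k G) : Prop :=
  ∃ (i : A →ₗ[k] B) (p : B →ₗ[k] D),
    (∀ g a, i (A.ρ g a) = B.ρ g (i a)) ∧ (∀ g b, p (B.ρ g b) = D.ρ g (p b)) ∧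
    Function.Injective i ∧ Function.Exact i p ∧ Function.Surjective p

/-- The (additive group of the) ring of finite dimensional virtual representations of `G`
over `k`. -/
abbrev VRep (k : Type u) [Field k] (G : Type v) [Group G] :=
  GrothendieckGroup (FDRep.SES (k := k) (G := G))

/-! ### The category `C^W(P)` -/

section

variable (k : Type u) [Field k] (W : Type v) [Group W] (P : Type u) [PartialOrder P]
  [MulAction W P]

/-- An object of `C^W(P)`: finite dimensional vector spaces `V x y` for `x ≤ y` in `P`,
together with linear maps `V x y → V (σ x) (σ y)` for `σ ∈ W`, subject to the identity and
composition laws. (The target is written `V x' y'` with `σ x = x'` and `σ y = y'`.) -/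
structure IntervalRep where
  V : ∀ (x y : P), x ≤ y → Type u
  [addCommGroup : ∀ x y h, AddCommGroup (V x y h)]
  [module : ∀ x y h, Module k (V x y h)]
  [finite : ∀ x y h, Module.Finite k (V x y h)]
  act : ∀ (σ : W) {x y x' y' : P}, σ • x = x' → σ • y = y' → ∀ (h : x ≤ y) (h' : x' ≤ y'),
    V x y h →ₗ[k] V x' y' h'
  act_one : ∀ {x y : P} (hx : (1 : W) • x = x) (hy : (1 : W) • y = y) (h : x ≤ y)
    (v : V x y h), act 1 hx hy h h v = v
  act_mul : ∀ (τ σ : W) {x y x' y' x'' y'' : P} (hx : σ • x = x') (hy : σ • y = y')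
    (hx' : τ • x' = x'') (hy' : τ • y' = y'') (hx'' : (τ * σ) • x = x'')
    (hy'' : (τ * σ) • y = y'') (h : x ≤ y) (h' : x' ≤ y') (h'' : x'' ≤ y'') (v : V x y h),
    act τ hx' hy' h' h'' (act σ hx hy h h' v) = act (τ * σ) hx'' hy'' h h'' v

end

namespace IntervalRep

attribute [instance] addCommGroup module finite

variable {k : Type u} [Field k] {W : Type v} [Group W] {P : Type u} [PartialOrder P]
  [MulAction W P]

/-- A morphism of `C^W(P)`: a family of linear maps compatible with the action of `W`. -/
@[ext] structure Hom (U V : IntervalRep k W P) where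
  app : ∀ x y (h : x ≤ y), U.V x y h →ₗ[k] V.V x y h
  comm : ∀ (σ : W) {x y x' y' : P} (hx : σ • x = x') (hy : σ • y = y') (h : x ≤ y)
    (h' : x' ≤ y') (u : U.V x y h),
    app x' y' h' (U.act σ hx hy h h' u) = V.act σ hx hy h h' (app x y h u)

/-- Existence of a short exact sequence `0 → A → B → D → 0` in `C^W(P)`. -/
def SES (A B D : IntervalRep k W P) : Prop :=
  ∃ (i : Hom A B) (p : Hom B D), ∀ x y h, Function.Injective (i.app x y h) ∧
    Function.Exact (i.app x y h) (p.app x y h) ∧ Function.Surjective (p.app x y h)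

/-- The stabilizer `W_{xy} = W_x ∩ W_y`. -/
abbrev stab (W : Type v) [Group W] {P : Type u} [MulAction W P] (x y : P) : Subgroup W :=
  MulAction.stabilizer W x ⊓ MulAction.stabilizer W y

/-- The representation of `W_{xy}` on `V x y`. -/
def rep (V : IntervalRep k W P) (x y : P) (h : x ≤ y) : FDRep k (stab W x y) :=
  FDRep.of (V := V.V x y h)
    { toFun := fun σ => V.act σ.1 σ.2.1 σ.2.2 h h
      map_one' := LinearMap.ext fun v => V.act_one _ _ h v
      map_mul' := fun τ σ => LinearMap.ext fun v =>
        (V.act_mul τ.1 σ.1 σ.2.1 σ.2.2 τ.2.1 τ.2.2 (τ * σ).2.1 (τ * σ).2.2 h h h v).symm }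

theorem rep_ses {A B D : IntervalRep k W P} (hs : SES A B D) (x y : P) (h : x ≤ y) :
    FDRep.SES (A.rep x y h) (B.rep x y h) (D.rep x y h) := by
  obtain ⟨i, p, hip⟩ := hs
  exact ⟨i.app x y h, p.app x y h, fun g a => i.comm g.1 g.2.1 g.2.2 h h a,
    fun g a => p.comm g.1 g.2.1 g.2.2 h h a, hip x y h⟩

/-- The unit object: `V x x` is the trivial one-dimensional representation of `W_x`, and
`V x y = 0` for `x < y`. -/
def unit : IntervalRep k W P where
  V x y _ := PLift (x = y) → k
  act σ {x y x' y'} hx hy _ _ := LinearMap.funLeft k k fun e =>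
    ⟨by have := e.down; rw [← hx, ← hy] at this; exact MulAction.injective σ this⟩
  act_one _ _ _ _ := rfl
  act_mul _ _ _ _ _ _ _ _ _ _ _ _ _ _ _ _ _ _ := rfl

/-- The identity morphism. -/
def Hom.id (U : IntervalRep k W P) : Hom U U where
  app _ _ _ := LinearMap.id
  comm _ _ _ _ _ _ _ _ _ _ := rfl

/-- The zero object. -/
def zero : IntervalRep k W P where
  V _ _ _ := PUnit
  act _ _ _ _ _ _ _ _ _ := 0
  act_one _ _ _ _ := rfl
  act_mul _ _ _ _ _ _ _ _ _ _ _ _ _ _ _ _ _ _ := rfl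

/-- Isomorphic objects have the same class. -/
theorem mk_eq {U V : IntervalRep k W P} (f : Hom U V)
    (hf : ∀ x y h, Function.Bijective (f.app x y h)) :
    GrothendieckGroup.mk SES U = GrothendieckGroup.mk SES V := by
  have hz : SES (zero : IntervalRep k W P) zero zero :=
    ⟨Hom.id _, Hom.id _, fun _ _ _ => ⟨fun _ _ h => h, fun _ => ⟨fun _ => ⟨0, rfl⟩, fun _ => rfl⟩,
      fun b => ⟨b, rfl⟩⟩⟩
  have h0 := GrothendieckGroup.mk_ses hz
  have hs : SES zero U V := by
    refine ⟨⟨fun _ _ _ => 0, fun σ _ _ _ _ hx hy h h' _ => ((U.act σ hx hy h h').map_zero).symm⟩,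
      f, fun x y h => ⟨fun _ _ _ => rfl, fun b => ⟨fun hb => ⟨0, ?_⟩, ?_⟩, (hf x y h).2⟩⟩
    · exact ((hf x y h).1 (hb.trans (map_zero _).symm)).symm
    · rintro ⟨_, rfl⟩; exact map_zero _
  have h1 := GrothendieckGroup.mk_ses hs
  have h2 : GrothendieckGroup.mk SES (zero : IntervalRep k W P) = 0 := by
    simpa using h0
  rw [h1, h2, zero_add]

open Classical in
theorem tensor_aux (U V : IntervalRep k W P) {x z x' z' : P} (σ : W) (hx : σ • x = x')
    (hz : σ • z = z') (y : Set.Icc x z) (y₁ y₂ : Set.Icc x' z') (h₁ : σ • y.1 = y₁.1)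
    (h₂ : σ • y.1 = y₂.1) (t : U.V x y y.2.1 ⊗[k] V.V y z y.2.2) :
    DirectSum.lof k (Set.Icc x' z') (fun y => U.V x' y y.2.1 ⊗[k] V.V y z' y.2.2) y₁
      (TensorProduct.map (U.act σ hx h₁ y.2.1 y₁.2.1) (V.act σ h₁ hz y.2.2 y₁.2.2) t) =
    DirectSum.lof k (Set.Icc x' z') (fun y => U.V x' y y.2.1 ⊗[k] V.V y z' y.2.2) y₂
      (TensorProduct.map (U.act σ hx h₂ y.2.1 y₂.2.1) (V.act σ h₂ hz y.2.2 y₂.2.2) t) := by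
  obtain rfl : y₁ = y₂ := Subtype.ext (h₁.symm.trans h₂)
  rfl

open Classical in
/-- Two linear maps out of `(U ⊗ V) x z` agree if they agree on the elements `u ⊗ v` of the
summands. -/
theorem tensor_hom_ext {U V : IntervalRep k W P} {x z : P} {N : Type*} [AddCommGroup N]
    [Module k N]
    {φ ψ : (⨁ y : Set.Icc x z, U.V x y y.2.1 ⊗[k] V.V y z y.2.2) →ₗ[k] N}
    (h : ∀ (y : Set.Icc x z) a b,
      φ (DirectSum.lof k _ (fun y : Set.Icc x z => U.V x y y.2.1 ⊗[k] V.V y z y.2.2) y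
        (a ⊗ₜ b)) =
      ψ (DirectSum.lof k _ (fun y : Set.Icc x z => U.V x y y.2.1 ⊗[k] V.V y z y.2.2) y
        (a ⊗ₜ b))) : φ = ψ :=
  DirectSum.linearMap_ext k fun y => TensorProduct.ext' fun a b => h y a b

theorem mem_Icc_smul [CovariantClass W P HSMul.hSMul LE.le] {x z x' z' : P} (σ : W) (hx : σ • x = x')
    (hz : σ • z = z') (y : Set.Icc x z) : σ • y.1 ∈ Set.Icc x' z' :=
  ⟨hx ▸ smul_mono_right σ y.2.1, hz ▸ smul_mono_right σ y.2.2⟩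

variable [CovariantClass W P HSMul.hSMul LE.le]

open Classical in
/-- The action on the tensor product: `u ⊗ v ↦ σ u ⊗ σ v`, taking the summand of `y` to the
summand of `σ y`. -/
def tensorAct (U V : IntervalRep k W P) (σ : W) {x z x' z' : P} (hx : σ • x = x')
    (hz : σ • z = z') :
    (⨁ y : Set.Icc x z, U.V x y y.2.1 ⊗[k] V.V y z y.2.2) →ₗ[k]
      ⨁ y : Set.Icc x' z', U.V x' y y.2.1 ⊗[k] V.V y z' y.2.2 :=
  DirectSum.toModule k _ _ fun y =>
    DirectSum.lof k (Set.Icc x' z') (fun y => U.V x' y y.2.1 ⊗[k] V.V y z' y.2.2)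
        ⟨σ • y.1, mem_Icc_smul σ hx hz y⟩ ∘ₗ
      TensorProduct.map (U.act σ hx rfl y.2.1 (mem_Icc_smul σ hx hz y).1)
        (V.act σ rfl hz y.2.2 (mem_Icc_smul σ hx hz y).2)

open Classical in
theorem tensorAct_lof (U V : IntervalRep k W P) (σ : W) {x z x' z' : P} (hx : σ • x = x')
    (hz : σ • z = z') (y : Set.Icc x z) (y' : Set.Icc x' z') (hy : σ • y.1 = y'.1)
    (a : U.V x y y.2.1) (b : V.V y z y.2.2) :
    tensorAct U V σ hx hz
      (DirectSum.lof k _ (fun y : Set.Icc x z => U.V x y y.2.1 ⊗[k] V.V y z y.2.2) y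
        (a ⊗ₜ b)) =
    DirectSum.lof k _ (fun y : Set.Icc x' z' => U.V x' y y.2.1 ⊗[k] V.V y z' y.2.2) y'
      (U.act σ hx hy y.2.1 y'.2.1 a ⊗ₜ V.act σ hy hz y.2.2 y'.2.2 b) := by
  rw [tensorAct, DirectSum.toModule_lof, LinearMap.comp_apply]
  exact tensor_aux U V σ hx hz y ⟨σ • y.1, mem_Icc_smul σ hx hz y⟩ y' rfl hy (a ⊗ₜ b)

variable [LocallyFiniteOrder P]

/-- The tensor product in `C^W(P)`: `(U ⊗ V) x z = ⨁_{x ≤ y ≤ z} U x y ⊗ V y z`. -/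
def tensor (U V : IntervalRep k W P) : IntervalRep k W P where
  V x z _ := ⨁ y : Set.Icc x z, U.V x y y.2.1 ⊗[k] V.V y z y.2.2
  act σ _ _ _ _ hx hz _ _ := tensorAct U V σ hx hz
  act_one {x z} hx hz h v := by
    classical
    have : tensorAct U V 1 hx hz = LinearMap.id := tensor_hom_ext fun y a b => by
      rw [tensorAct_lof U V 1 hx hz y y (one_smul _ _), U.act_one, V.act_one]; rfl
    rw [this]; rfl
  act_mul τ σ x z x' z' x'' z'' hx hz hx' hz' hx'' hz'' h h' h'' v := by
    classical
    have : tensorAct U V τ hx' hz' ∘ₗ tensorAct U V σ hx hz = tensorAct U V (τ * σ) hx'' hz'' :=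
      tensor_hom_ext fun y a b => by
        have e : τ • σ • y.1 = (τ * σ) • y.1 := (mul_smul _ _ _).symm
        have m := mem_Icc_smul σ hx hz y
        have m' := mem_Icc_smul τ hx' hz' ⟨_, m⟩
        rw [LinearMap.comp_apply, tensorAct_lof U V σ hx hz y ⟨_, m⟩ rfl,
          tensorAct_lof U V τ hx' hz' ⟨_, m⟩ ⟨_, m'⟩ rfl,
          tensorAct_lof U V (τ * σ) hx'' hz'' y ⟨_, m'⟩ e.symm]
        rw [U.act_mul, V.act_mul]
    exact LinearMap.congr_fun this v

open Classical in
theorem tensor_act_lof (U V : IntervalRep k W P) (σ : W) {x z x' z' : P} (hx : σ • x = x')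
    (hz : σ • z = z') (h : x ≤ z) (h' : x' ≤ z') (y : Set.Icc x z) (y' : Set.Icc x' z')
    (hy : σ • y.1 = y'.1) (a : U.V x y y.2.1) (b : V.V y z y.2.2) :
    (tensor U V).act σ hx hz h h'
      (DirectSum.lof k _ (fun y : Set.Icc x z => U.V x y y.2.1 ⊗[k] V.V y z y.2.2) y
        (a ⊗ₜ b)) =
    DirectSum.lof k _ (fun y : Set.Icc x' z' => U.V x' y y.2.1 ⊗[k] V.V y z' y.2.2) y'
      (U.act σ hx hy y.2.1 y'.2.1 a ⊗ₜ V.act σ hy hz y.2.2 y'.2.2 b) :=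
  tensorAct_lof U V σ hx hz y y' hy a b

/-- Functoriality of the tensor product. -/
def tensorMap {U U' V V' : IntervalRep k W P} (f : Hom U U') (g : Hom V V') :
    Hom (tensor U V) (tensor U' V') where
  app x z _ := DirectSum.lmap fun y : Set.Icc x z =>
    TensorProduct.map (f.app x y y.2.1) (g.app y z y.2.2)
  comm σ {x z x' z'} hx hz h h' u := by
    classical
    have : (DirectSum.lmap fun y : Set.Icc x' z' =>
          TensorProduct.map (f.app x' y y.2.1) (g.app y z' y.2.2)) ∘ₗ tensorAct U V σ hx hz =
        tensorAct U' V' σ hx hz ∘ₗ (DirectSum.lmap fun y : Set.Icc x z =>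
          TensorProduct.map (f.app x y y.2.1) (g.app y z y.2.2)) :=
      tensor_hom_ext fun y a b => by
        have m := mem_Icc_smul σ hx hz y
        rw [LinearMap.comp_apply, LinearMap.comp_apply,
          tensorAct_lof U V σ hx hz y ⟨_, m⟩ rfl, DirectSum.lmap_lof, DirectSum.lmap_lof,
          TensorProduct.map_tmul, TensorProduct.map_tmul,
          tensorAct_lof U' V' σ hx hz y ⟨_, m⟩ rfl, f.comm, g.comm]
    exact LinearMap.congr_fun this u

theorem exact_lmap {ι : Type*} {A B D : ι → Type*} [∀ i, AddCommGroup (A i)]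
    [∀ i, AddCommGroup (B i)] [∀ i, AddCommGroup (D i)] [∀ i, Module k (A i)]
    [∀ i, Module k (B i)] [∀ i, Module k (D i)] (f : ∀ i, A i →ₗ[k] B i)
    (g : ∀ i, B i →ₗ[k] D i) (h : ∀ i, Function.Exact (f i) (g i)) :
    Function.Exact (DirectSum.lmap f) (DirectSum.lmap g) := by
  rw [LinearMap.exact_iff, DirectSum.range_lmap, DirectSum.ker_lmap]
  simp_rw [fun i => (LinearMap.exact_iff.1 (h i))]

theorem tensor_ses_right (U : IntervalRep k W P) {A B D : IntervalRep k W P} (h : SES A B D) :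
    SES (tensor U A) (tensor U B) (tensor U D) := by
  obtain ⟨i, p, hip⟩ := h
  refine ⟨tensorMap (Hom.id U) i, tensorMap (Hom.id U) p, fun x z hxz => ⟨?_, ?_, ?_⟩⟩
  · exact (DirectSum.lmap_injective _).2 fun (y : Set.Icc x z) =>
      Module.Flat.lTensor_preserves_injective_linearMap _ (hip y z y.2.2).1
  · exact exact_lmap _ _ fun (y : Set.Icc x z) =>
      lTensor_exact _ (hip y z y.2.2).2.1 (hip y z y.2.2).2.2
  · exact (DirectSum.lmap_surjective _).2 fun (y : Set.Icc x z) => LinearMap.lTensor_surjective _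
      (hip y z y.2.2).2.2

theorem tensor_ses_left (U : IntervalRep k W P) {A B D : IntervalRep k W P} (h : SES A B D) :
    SES (tensor A U) (tensor B U) (tensor D U) := by
  obtain ⟨i, p, hip⟩ := h
  refine ⟨tensorMap i (Hom.id U), tensorMap p (Hom.id U), fun x z hxz => ⟨?_, ?_, ?_⟩⟩
  · exact (DirectSum.lmap_injective _).2 fun (y : Set.Icc x z) =>
      Module.Flat.rTensor_preserves_injective_linearMap _ (hip x y y.2.1).1
  · exact exact_lmap _ _ fun (y : Set.Icc x z) =>
      rTensor_exact _ (hip x y y.2.1).2.1 (hip x y y.2.1).2.2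
  · exact (DirectSum.lmap_surjective _).2 fun (y : Set.Icc x z) => LinearMap.rTensor_surjective _
      (hip x y y.2.1).2.2

/-! ### The ring structure -/

/-- The summand `u ⊗ v` of the tensor product, for `u` in `U x y` and `v` in `V y z`. -/
def pure (U V : IntervalRep k W P) {x z : P} (h : x ≤ z) (y : Set.Icc x z) (a : U.V x y y.2.1)
    (b : V.V y z y.2.2) : (tensor U V).V x z h := by
  classical
  exact DirectSum.lof k _ (fun y : Set.Icc x z => U.V x y y.2.1 ⊗[k] V.V y z y.2.2) y (a ⊗ₜ b)

theorem pure_act (U V : IntervalRep k W P) (σ : W) {x z x' z' : P} (hx : σ • x = x')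
    (hz : σ • z = z') (h : x ≤ z) (h' : x' ≤ z') (y : Set.Icc x z) (y' : Set.Icc x' z')
    (hy : σ • y.1 = y'.1) (a : U.V x y y.2.1) (b : V.V y z y.2.2) :
    (tensor U V).act σ hx hz h h' (pure U V h y a b) =
      pure U V h' y' (U.act σ hx hy y.2.1 y'.2.1 a) (V.act σ hy hz y.2.2 y'.2.2 b) :=
  tensorAct_lof U V σ hx hz y y' hy a b

/-- Construction of linear maps out of the tensor product. -/
def elim (U V : IntervalRep k W P) {x z : P} (h : x ≤ z) {N : Type*} [AddCommGroup N]
    [Module k N] (φ : ∀ y : Set.Icc x z, U.V x y y.2.1 →ₗ[k] V.V y z y.2.2 →ₗ[k] N) :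
    (tensor U V).V x z h →ₗ[k] N := by
  classical
  exact DirectSum.toModule k _ _ fun y => TensorProduct.lift (φ y)

@[simp] theorem elim_pure (U V : IntervalRep k W P) {x z : P} (h : x ≤ z) {N : Type*}
    [AddCommGroup N] [Module k N]
    (φ : ∀ y : Set.Icc x z, U.V x y y.2.1 →ₗ[k] V.V y z y.2.2 →ₗ[k] N) (y : Set.Icc x z)
    (a : U.V x y y.2.1) (b : V.V y z y.2.2) : elim U V h φ (pure U V h y a b) = φ y a b := by
  classical
  have : elim U V h φ (pure U V h y a b) = TensorProduct.lift (φ y) (a ⊗ₜ[k] b) :=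
    DirectSum.toModule_lof (φ := fun y => TensorProduct.lift (φ y)) k y (a ⊗ₜ[k] b)
  rw [this, TensorProduct.lift.tmul]

theorem pure_ext {U V : IntervalRep k W P} {x z : P} {h : x ≤ z} {N : Type*}
    [AddCommGroup N] [Module k N] {φ ψ : (tensor U V).V x z h →ₗ[k] N}
    (e : ∀ y a b, φ (pure U V h y a b) = ψ (pure U V h y a b)) : φ = ψ :=
  tensor_hom_ext e

/-- `pure` as a bilinear map. -/
def pureₗ (U V : IntervalRep k W P) {x z : P} (h : x ≤ z) (y : Set.Icc x z) :
    U.V x y y.2.1 →ₗ[k] V.V y z y.2.2 →ₗ[k] (tensor U V).V x z h := by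
  classical
  exact (TensorProduct.mk k _ _).compr₂
    (DirectSum.lof k _ (fun y : Set.Icc x z => U.V x y y.2.1 ⊗[k] V.V y z y.2.2) y)

@[simp] theorem pureₗ_apply (U V : IntervalRep k W P) {x z : P} (h : x ≤ z) (y : Set.Icc x z)
    (a : U.V x y y.2.1) (b : V.V y z y.2.2) : pureₗ U V h y a b = pure U V h y a b := rfl

theorem mk_tensor_assoc (A B D : IntervalRep k W P) :
    GrothendieckGroup.mk SES (tensor (tensor A B) D) =
      GrothendieckGroup.mk SES (tensor A (tensor B D)) := by
  let F : ∀ x w (h : x ≤ w), (tensor (tensor A B) D).V x w h →ₗ[k]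
      (tensor A (tensor B D)).V x w h := fun x w h =>
    elim (tensor A B) D h fun z => elim A B z.2.1 fun y =>
      LinearMap.mk₂ k (fun a b => (pureₗ A (tensor B D) h ⟨y, y.2.1, y.2.2.trans z.2.2⟩ a) ∘ₗ
          (pureₗ B D (y.2.2.trans z.2.2) ⟨z, y.2.2, z.2.2⟩ b))
        (fun _ _ _ => by ext; simp [-pureₗ_apply]) (fun _ _ _ => by ext; simp [-pureₗ_apply])
        (fun _ _ _ => by ext; simp [-pureₗ_apply]) (fun _ _ _ => by ext; simp [-pureₗ_apply])
  let G : ∀ x w (h : x ≤ w), (tensor A (tensor B D)).V x w h →ₗ[k]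
      (tensor (tensor A B) D).V x w h := fun x w h =>
    elim A (tensor B D) h fun y => LinearMap.flip (elim B D y.2.2 fun z =>
      LinearMap.mk₂ k (fun b d =>
          ((pureₗ (tensor A B) D h ⟨z, y.2.1.trans z.2.1, z.2.2⟩).flip d) ∘ₗ
            ((pureₗ A B (y.2.1.trans z.2.1) ⟨y, y.2.1, z.2.1⟩).flip b))
        (fun _ _ _ => by ext; simp [-pureₗ_apply]) (fun _ _ _ => by ext; simp [-pureₗ_apply])
        (fun _ _ _ => by ext; simp [-pureₗ_apply]) (fun _ _ _ => by ext; simp [-pureₗ_apply]))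
  have hF : ∀ x w h z (y : Set.Icc x z.1) a b d,
      F x w h (pure (tensor A B) D h z (pure A B z.2.1 y a b) d) =
        pure A (tensor B D) h ⟨y, y.2.1, y.2.2.trans z.2.2⟩ a
          (pure B D (y.2.2.trans z.2.2) ⟨z, y.2.2, z.2.2⟩ b d) := fun x w h z y a b d => by
    simp only [F, elim_pure]; rfl
  have hG : ∀ x w h y (z : Set.Icc y.1 w) a b d,
      G x w h (pure A (tensor B D) h y a (pure B D y.2.2 z b d)) =
        pure (tensor A B) D h ⟨z, y.2.1.trans z.2.1, z.2.2⟩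
          (pure A B (y.2.1.trans z.2.1) ⟨y, y.2.1, z.2.1⟩ a b) d := fun x w h y z a b d => by
    simp only [G, elim_pure, LinearMap.flip_apply]; rfl
  have extL : ∀ {x w : P} {h : x ≤ w} {N : Type u} [AddCommGroup N] [Module k N]
      {φ ψ : (tensor (tensor A B) D).V x w h →ₗ[k] N},
      (∀ z (y : Set.Icc x z.1) a b d,
        φ (pure (tensor A B) D h z (pure A B z.2.1 y a b) d) =
          ψ (pure (tensor A B) D h z (pure A B z.2.1 y a b) d)) → φ = ψ := by
    intro x w h N _ _ φ ψ e
    refine pure_ext fun z t d => ?_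
    have : φ ∘ₗ (pureₗ (tensor A B) D h z).flip d = ψ ∘ₗ (pureₗ (tensor A B) D h z).flip d :=
      pure_ext fun y a b => e z y a b d
    exact LinearMap.congr_fun this t
  have extR : ∀ {x w : P} {h : x ≤ w} {N : Type u} [AddCommGroup N] [Module k N]
      {φ ψ : (tensor A (tensor B D)).V x w h →ₗ[k] N},
      (∀ y (z : Set.Icc y.1 w) a b d,
        φ (pure A (tensor B D) h y a (pure B D y.2.2 z b d)) =
          ψ (pure A (tensor B D) h y a (pure B D y.2.2 z b d))) → φ = ψ := by
    intro x w h N _ _ φ ψ e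
    refine pure_ext fun y a t => ?_
    have : φ ∘ₗ pureₗ A (tensor B D) h y a = ψ ∘ₗ pureₗ A (tensor B D) h y a :=
      pure_ext fun z b d => e y z a b d
    exact LinearMap.congr_fun this t
  refine mk_eq ⟨F, ?_⟩ fun x w h => ?_
  · intro σ x w x' w' hx hw h h' t
    have : F x' w' h' ∘ₗ (tensor (tensor A B) D).act σ hx hw h h' =
        (tensor A (tensor B D)).act σ hx hw h h' ∘ₗ F x w h := extL fun z y a b d => by
      have mz := mem_Icc_smul σ hx hw z
      have my := mem_Icc_smul σ hx (rfl : σ • z.1 = _) y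
      simp only [LinearMap.comp_apply]
      rw [hF, pure_act (tensor A B) D σ hx hw h h' z ⟨_, mz⟩ rfl,
        pure_act A B σ hx rfl z.2.1 mz.1 y ⟨_, my⟩ rfl, hF,
        pure_act A (tensor B D) σ hx hw h h' _ ⟨σ • y.1, my.1, my.2.trans mz.2⟩ rfl,
        pure_act B D σ rfl hw _ (my.2.trans mz.2) _ ⟨σ • z.1, my.2, mz.2⟩ rfl]
    exact LinearMap.congr_fun this t
  · have h1 : G x w h ∘ₗ F x w h = LinearMap.id := extL fun z y a b d => by
      rw [LinearMap.comp_apply, hF, hG]; rfl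
    have h2 : F x w h ∘ₗ G x w h = LinearMap.id := extR fun y z a b d => by
      rw [LinearMap.comp_apply, hG, hF]; rfl
    exact Function.bijective_iff_has_inverse.2
      ⟨G x w h, LinearMap.congr_fun h1, LinearMap.congr_fun h2⟩

theorem mk_unit_tensor (V : IntervalRep k W P) :
    GrothendieckGroup.mk SES (tensor unit V) = GrothendieckGroup.mk SES V := by
  let F : ∀ x z (h : x ≤ z), (tensor unit V).V x z h →ₗ[k] V.V x z h := fun x z h =>
    elim unit V h fun y => by
      classical
      exact if e : x = y then
        LinearMap.mk₂ k (fun (a : PLift (x = y.1) → k) v => a ⟨e⟩ • V.act 1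
            ((one_smul _ _).trans e.symm) (one_smul _ _) y.2.2 h v)
          (fun _ _ _ => add_smul _ _ _) (fun _ _ _ => mul_smul _ _ _)
          (fun _ _ _ => by rw [map_add, smul_add])
          (fun _ _ _ => by rw [map_smul, smul_comm])
      else 0
  have hF : ∀ x z h (a : PLift (x = x) → k) v,
      F x z h (pure unit V h ⟨x, Set.left_mem_Icc.2 h⟩ a v) = a ⟨rfl⟩ • v := fun x z h a v => by
    refine (elim_pure _ _ h _ _ _ _).trans ?_
    rw [dif_pos rfl]
    exact congrArg (a ⟨rfl⟩ • ·) (V.act_one _ _ _ v)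
  let G : ∀ x z (h : x ≤ z), V.V x z h →ₗ[k] (tensor unit V).V x z h := fun x z h =>
    pureₗ unit V h ⟨x, Set.left_mem_Icc.2 h⟩ (fun _ => 1)
  have ext : ∀ {x z : P} {h : x ≤ z} {N : Type u} [AddCommGroup N] [Module k N]
      {φ ψ : (tensor unit V).V x z h →ₗ[k] N},
      (∀ v, φ (pure unit V h ⟨x, Set.left_mem_Icc.2 h⟩ (fun _ => 1) v) =
          ψ (pure unit V h ⟨x, Set.left_mem_Icc.2 h⟩ (fun _ => 1) v)) → φ = ψ := by
    intro x z h N _ _ φ ψ e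
    refine pure_ext fun y a v => ?_
    obtain ⟨y, hy⟩ := y
    by_cases hxy : x = y
    · subst hxy
      have ha : a = a ⟨rfl⟩ • (fun _ => 1 : PLift (x = x) → k) := by
        funext i; exact (mul_one _).symm
      have hp : pure unit V h ⟨x, hy⟩ a v =
          a ⟨rfl⟩ • pure unit V h ⟨x, hy⟩ (fun _ => 1 : PLift (x = x) → k) v := by
        conv_lhs => rw [ha]
        exact LinearMap.congr_fun ((pureₗ unit V h ⟨x, hy⟩).map_smul _ _) v
      rw [hp, map_smul, map_smul, e]
    · have ha : a = 0 := by funext i; exact absurd i.down hxy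
      have hp : pure unit V h ⟨y, hy⟩ a v = 0 := by
        rw [ha]; exact LinearMap.congr_fun ((pureₗ unit V h ⟨y, hy⟩).map_zero) v
      rw [hp, map_zero, map_zero]
  refine mk_eq ⟨F, ?_⟩ fun x z h => ?_
  · intro σ x z x' z' hx hz h h' t
    have : F x' z' h' ∘ₗ (tensor unit V).act σ hx hz h h' =
        V.act σ hx hz h h' ∘ₗ F x z h := ext fun v => by
      simp only [LinearMap.comp_apply]
      rw [hF]
      refine (congrArg (F x' z' h') (pure_act unit V σ hx hz h h' ⟨x, Set.left_mem_Icc.2 h⟩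
        ⟨x', Set.left_mem_Icc.2 h'⟩ hx (fun _ => 1) v)).trans ?_
      exact (hF _ _ _ _ _).trans ((one_smul k _).trans (congrArg _ (one_smul k v).symm))
    exact LinearMap.congr_fun this t
  · have h1 : G x z h ∘ₗ F x z h = LinearMap.id := ext fun v => by
      rw [LinearMap.comp_apply, hF]
      exact congrArg (G x z h) (one_smul k v)
    exact Function.bijective_iff_has_inverse.2
      ⟨G x z h, LinearMap.congr_fun h1, fun v => (hF _ _ _ _ _).trans (one_smul k v)⟩

theorem mk_tensor_unit (V : IntervalRep k W P) :
    GrothendieckGroup.mk SES (tensor V unit) = GrothendieckGroup.mk SES V := by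
  let F : ∀ x z (h : x ≤ z), (tensor V unit).V x z h →ₗ[k] V.V x z h := fun x z h =>
    elim V unit h fun y => by
      classical
      exact if e : y = z then
        LinearMap.mk₂ k (fun v (a : PLift (y.1 = z) → k) => a ⟨e⟩ • V.act 1
            (one_smul _ _) ((one_smul _ _).trans e) y.2.1 h v)
          (fun _ _ _ => by rw [map_add, smul_add])
          (fun _ _ _ => by rw [map_smul, smul_comm])
          (fun _ _ _ => add_smul _ _ _) (fun _ _ _ => mul_smul _ _ _)
      else 0
  have hF : ∀ x z h (a : PLift (z = z) → k) v,
      F x z h (pure V unit h ⟨z, Set.right_mem_Icc.2 h⟩ v a) = a ⟨rfl⟩ • v := fun x z h a v => by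
    refine (elim_pure _ _ h _ _ _ _).trans ?_
    rw [dif_pos rfl]
    exact congrArg (a ⟨rfl⟩ • ·) (V.act_one _ _ _ v)
  let G : ∀ x z (h : x ≤ z), V.V x z h →ₗ[k] (tensor V unit).V x z h := fun x z h =>
    (pureₗ V unit h ⟨z, Set.right_mem_Icc.2 h⟩).flip (fun _ => 1)
  have ext : ∀ {x z : P} {h : x ≤ z} {N : Type u} [AddCommGroup N] [Module k N]
      {φ ψ : (tensor V unit).V x z h →ₗ[k] N},
      (∀ v, φ (pure V unit h ⟨z, Set.right_mem_Icc.2 h⟩ v (fun _ => 1)) =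
          ψ (pure V unit h ⟨z, Set.right_mem_Icc.2 h⟩ v (fun _ => 1))) → φ = ψ := by
    intro x z h N _ _ φ ψ e
    refine pure_ext fun y v a => ?_
    obtain ⟨y, hy⟩ := y
    by_cases hxy : y = z
    · subst hxy
      have ha : a = a ⟨rfl⟩ • (fun _ => 1 : PLift (y = y) → k) := by
        funext i; exact (mul_one _).symm
      have hp : pure V unit h ⟨y, hy⟩ v a =
          a ⟨rfl⟩ • pure V unit h ⟨y, hy⟩ v (fun _ => 1 : PLift (y = y) → k) := by
        conv_lhs => rw [ha]
        exact (pureₗ V unit h ⟨y, hy⟩ v).map_smul _ _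
      rw [hp, map_smul, map_smul, e]
    · have ha : a = 0 := by funext i; exact absurd i.down hxy
      have hp : pure V unit h ⟨y, hy⟩ v a = 0 := by
        rw [ha]; exact (pureₗ V unit h ⟨y, hy⟩ v).map_zero
      rw [hp, map_zero, map_zero]
  refine mk_eq ⟨F, ?_⟩ fun x z h => ?_
  · intro σ x z x' z' hx hz h h' t
    have : F x' z' h' ∘ₗ (tensor V unit).act σ hx hz h h' =
        V.act σ hx hz h h' ∘ₗ F x z h := ext fun v => by
      simp only [LinearMap.comp_apply]
      rw [hF]
      refine (congrArg (F x' z' h') (pure_act V unit σ hx hz h h' ⟨z, Set.right_mem_Icc.2 h⟩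
        ⟨z', Set.right_mem_Icc.2 h'⟩ hz v (fun _ => 1))).trans ?_
      exact (hF _ _ _ _ _).trans ((one_smul k _).trans (congrArg _ (one_smul k v).symm))
    exact LinearMap.congr_fun this t
  · have h1 : G x z h ∘ₗ F x z h = LinearMap.id := ext fun v => by
      rw [LinearMap.comp_apply, hF]
      exact congrArg (G x z h) (one_smul k v)
    exact Function.bijective_iff_has_inverse.2
      ⟨G x z h, LinearMap.congr_fun h1, fun v => (hF _ _ _ _ _).trans (one_smul k v)⟩

end IntervalRep

/-- The equivariant incidence algebra `I^W(P)`: the Grothendieck ring of `C^W(P)`. -/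
abbrev EquivIncidenceAlgebra (k : Type u) [Field k] (W : Type v) [Group W] (P : Type u)
    [PartialOrder P] [MulAction W P] :=
  GrothendieckGroup (IntervalRep.SES (k := k) (W := W) (P := P))

namespace EquivIncidenceAlgebra

variable {k : Type u} [Field k] {W : Type v} [Group W] {P : Type u} [PartialOrder P]
  [MulAction W P]

/-- The class `[V]` of an object of `C^W(P)`. -/
abbrev mk (V : IntervalRep k W P) : EquivIncidenceAlgebra k W P :=
  GrothendieckGroup.mk IntervalRep.SES V

/-- The component `f_{xy} ∈ VRep(W_{xy})` of `f ∈ I^W(P)`; it is additive in `f` and given on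
objects by `[V]_{xy} = [V_{xy}]`. -/
def comp (x y : P) (h : x ≤ y) :
    EquivIncidenceAlgebra k W P →+ VRep k (IntervalRep.stab W x y) :=
  GrothendieckGroup.lift (fun V => GrothendieckGroup.mk FDRep.SES (V.rep x y h))
    fun _ _ _ hs => GrothendieckGroup.mk_ses (IntervalRep.rep_ses hs x y h)

variable [LocallyFiniteOrder P] [CovariantClass W P HSMul.hSMul LE.le]

/-- The biadditive product with `[U] [V] = [U ⊗ V]`. -/
def mulHom : EquivIncidenceAlgebra k W P →+
    EquivIncidenceAlgebra k W P →+ EquivIncidenceAlgebra k W P :=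
  GrothendieckGroup.lift
    (fun U => GrothendieckGroup.lift (fun V => mk (IntervalRep.tensor U V))
      fun _ _ _ hs => GrothendieckGroup.mk_ses (IntervalRep.tensor_ses_right U hs))
    fun _ _ _ hs => GrothendieckGroup.hom_ext fun V => by
      simpa using GrothendieckGroup.mk_ses (IntervalRep.tensor_ses_left V hs)

instance : Ring (EquivIncidenceAlgebra k W P) :=
  { (inferInstance : AddCommGroup (EquivIncidenceAlgebra k W P)) with
    mul := fun f g => mulHom f g
    one := mk IntervalRep.unit
    left_distrib := fun f g h => map_add (mulHom f) g h
    right_distrib := fun f g h => by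
      change mulHom (f + g) h = mulHom f h + mulHom g h
      rw [map_add, AddMonoidHom.add_apply]
    zero_mul := fun f => by
      change mulHom 0 f = 0
      rw [map_zero, AddMonoidHom.zero_apply]
    mul_zero := fun f => map_zero (mulHom f)
    mul_assoc := fun f g h => by
      have : AddMonoidHom.compr₂ mulHom mulHom =
          (AddMonoidHom.compHom.flip mulHom).comp (AddMonoidHom.compHom.comp
            (mulHom (k := k) (W := W) (P := P))) :=
        GrothendieckGroup.hom_ext fun A => GrothendieckGroup.hom_ext fun B =>
          GrothendieckGroup.hom_ext fun D => by
            simp [mulHom, IntervalRep.mk_tensor_assoc]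
      exact DFunLike.congr_fun (DFunLike.congr_fun (DFunLike.congr_fun this f) g) h
    one_mul := fun f => by
      have : mulHom (mk IntervalRep.unit) = AddMonoidHom.id (EquivIncidenceAlgebra k W P) :=
        GrothendieckGroup.hom_ext fun V => by simp [mulHom, IntervalRep.mk_unit_tensor]
      exact DFunLike.congr_fun this f
    mul_one := fun f => by
      have : mulHom.flip (mk IntervalRep.unit) =
          AddMonoidHom.id (EquivIncidenceAlgebra k W P) :=
        GrothendieckGroup.hom_ext fun V => by simp [mulHom, IntervalRep.mk_tensor_unit]
      exact DFunLike.congr_fun this f }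

theorem mk_mul_mk (U V : IntervalRep k W P) : mk U * mk V = mk (IntervalRep.tensor U V) := by
  change mulHom _ _ = _
  simp [mulHom]

theorem one_def : (1 : EquivIncidenceAlgebra k W P) = mk IntervalRep.unit := rfl

end EquivIncidenceAlgebra

/-! ### Equivariant Kazhdan--Lusztig--Stanley theory -/

/-- A `W`-invariant weak rank function on `P`; only the values `r x y` with `x ≤ y` matter. -/
structure WeakRankFunction (W : Type v) [Group W] (P : Type u) [PartialOrder P]
    [MulAction W P] where
  r : P → P → ℕ
  pos : ∀ {x y : P}, x < y → 0 < r x y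
  add : ∀ {x y z : P}, x ≤ y → y ≤ z → r x y + r y z = r x z
  smul : ∀ (σ : W) {x y : P}, x ≤ y → r (σ • x) (σ • y) = r x y

namespace EquivKLS

variable {k : Type u} [Field k] {W : Type v} [Group W] {P : Type u} [PartialOrder P]
  [LocallyFiniteOrder P] [MulAction W P] [CovariantClass W P HSMul.hSMul LE.le]

/-- The coefficient of `t ^ n` in `f_{xy}(t)`, an element of `VRep(W_{xy})`, for a series
`f = ∑ fₙ tⁿ` with `fₙ ∈ I^W(P)`. -/
def coeffAt (f : PowerSeries (EquivIncidenceAlgebra k W P)) (x y : P) (h : x ≤ y) (n : ℕ) :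
    VRep k (IntervalRep.stab W x y) :=
  EquivIncidenceAlgebra.comp x y h (PowerSeries.coeff n f)

/-- Membership in `𝓘^W(P)`: every `f_{xy}(t)` is a polynomial of degree at most `r_{xy}`. A
series with coefficients in `I^W(P)` is used in place of a polynomial because the degrees
`r_{xy}` need not be bounded when `P` is infinite. -/
def MemI (ρ : WeakRankFunction W P) (f : PowerSeries (EquivIncidenceAlgebra k W P)) : Prop :=
  ∀ x y (h : x ≤ y) n, ρ.r x y < n → coeffAt f x y h n = 0

/-- Membership in `𝓘^W_{1/2}(P)`: `deg f_{xy}(t) < r_{xy} / 2` for `x < y`, and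
`f_{xx}(t) = δ_{xx}(t)`, where `δ` is the unit. -/
def MemIHalf (ρ : WeakRankFunction W P) (f : PowerSeries (EquivIncidenceAlgebra k W P)) :
    Prop :=
  (∀ x y (h : x < y) n, ρ.r x y ≤ 2 * n → coeffAt f x y h.le n = 0) ∧
    ∀ x n, coeffAt f x x le_rfl n = coeffAt 1 x x le_rfl n

/-- The coefficient of `t ^ n` in `t ^ r_{xy} f_{xy}(t⁻¹)`. -/
def barCoeffAt (ρ : WeakRankFunction W P) (f : PowerSeries (EquivIncidenceAlgebra k W P))
    (x y : P) (h : x ≤ y) (n : ℕ) : VRep k (IntervalRep.stab W x y) :=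
  if n ≤ ρ.r x y then coeffAt f x y h (ρ.r x y - n) else 0

/-- `f'` is `f̄`, that is, `f'_{xy}(t) = t ^ r_{xy} f_{xy}(t⁻¹)` for all `x ≤ y`. -/
def IsBar (ρ : WeakRankFunction W P) (f f' : PowerSeries (EquivIncidenceAlgebra k W P)) :
    Prop :=
  ∀ x y (h : x ≤ y) n, coeffAt f' x y h n = barCoeffAt ρ f x y h n

/-- `κ` is a `P`-kernel: `κ ∈ 𝓘^W(P)`, `κ_{xx}(t) = δ_{xx}(t)`, and `κ̄` is inverse to `κ`. -/
structure IsPKernel (ρ : WeakRankFunction W P)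
    (κ : PowerSeries (EquivIncidenceAlgebra k W P)) : Prop where
  mem : MemI ρ κ
  diag : ∀ x n, coeffAt κ x x le_rfl n = coeffAt 1 x x le_rfl n
  bar_inv : ∃ κ', IsBar ρ κ κ' ∧ κ * κ' = 1 ∧ κ' * κ = 1

/-- `f` is the right equivariant KLS-function of `κ`: `f ∈ 𝓘^W_{1/2}(P)` and `f̄ = κ f`. -/
def IsRightKLS (ρ : WeakRankFunction W P)
    (κ f : PowerSeries (EquivIncidenceAlgebra k W P)) : Prop :=
  MemIHalf ρ f ∧ IsBar ρ f (κ * f)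

/-- `g` is the left equivariant KLS-function of `κ`: `g ∈ 𝓘^W_{1/2}(P)` and `ḡ = g κ`. -/
def IsLeftKLS (ρ : WeakRankFunction W P)
    (κ g : PowerSeries (EquivIncidenceAlgebra k W P)) : Prop :=
  MemIHalf ρ g ∧ IsBar ρ g (g * κ)

end EquivKLS

end

/-!
The bar involution is multiplicative on series with `deg f_{xy} ≤ r_{xy}`: the component at
`x ≤ z` of a product is a sum over orbits of points `y` in `[x, z]` of terms biadditive in the
components at `x ≤ y` and `y ≤ z`, and reversing the coefficients of the two factors reverses
those of each term because `r_{xy} + r_{yz} = r_{xz}`. The orbits arise since the group `W_{xz}`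
permutes the summands of `(U ⊗ V)_{xz}`; the summands in the orbit of `y` form the representation
coinduced from the stabilizer of `y`. Now `Z = g (κ f) = g f̄` and also `Z = (g κ) f = ḡ f`, and
bar exchanges these two factorizations.
-/

noncomputable section

section Coinduction

open Representation

variable {k G H A B D : Type*}

section Functoriality

variable [Semiring k] [Monoid G] [Monoid H] (φ : G →* H) [AddCommMonoid A] [Module k A]
  [AddCommMonoid B] [Module k B] [AddCommMonoid D] [Module k D]
  {α : Representation k G A} {β : Representation k G B} {δ : Representation k G D}

theorem coindMap_injective {i : α.IntertwiningMap β} (hi : Function.Injective i) :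
    Function.Injective (coindMap φ i) := fun _ _ h =>
  Subtype.ext (hi.comp_left (congrArg Subtype.val h))

theorem coindMap_exact {i : α.IntertwiningMap β} {p : β.IntertwiningMap δ}
    (hi : Function.Injective i) (hip : Function.Exact i p) :
    Function.Exact (coindMap φ i) (coindMap φ p) := by
  intro ψ
  constructor
  · intro hψ
    choose χ hχ using fun h => (hip (ψ.1 h)).1 (congrFun (congrArg Subtype.val hψ) h)
    refine ⟨⟨χ, fun g h => hi ?_⟩, Subtype.ext (funext hχ)⟩
    rw [hχ, i.isIntertwining, hχ, ψ.2]
  · rintro ⟨χ, rfl⟩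
    exact Subtype.ext (funext fun h => hip.apply_apply_eq_zero (χ.1 h))

end Functoriality

section Subgroup

variable [Semiring k] [Group G] {S : Subgroup G} {T : Set G} [AddCommMonoid A] [Module k A]
  [AddCommMonoid B] [Module k B] {α : Representation k S A} {β : Representation k S B}

/-- A function in the coinduced representation is determined by arbitrary values on a set of
representatives of the right cosets. -/
def coindVEquiv (hT : Subgroup.IsComplement (S : Set G) T) (α : Representation k S A) :
    coindV S.subtype α ≃ₗ[k] (T → A) where
  toFun ψ t := ψ.1 t
  map_add' _ _ := rfl
  map_smul' _ _ := rfl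
  invFun χ := ⟨fun g => α (hT.equiv g).1 (χ (hT.equiv g).2), fun s g => by
    change α (hT.equiv (s * g)).1 (χ (hT.equiv (s * g)).2) = _
    rw [hT.equiv_mul_left, map_mul, Module.End.mul_apply]⟩
  left_inv ψ := Subtype.ext <| funext fun g =>
    (ψ.2 _ _).symm.trans (congrArg ψ.1 (hT.equiv_fst_mul_equiv_snd g))
  right_inv χ := funext fun t => by
    have ht : hT.equiv t = (1, t) := by
      rw [← Equiv.eq_symm_apply]
      exact (one_mul _).symm
    simp only [ht, map_one, Module.End.one_apply]

theorem coindMap_surjective {p : α.IntertwiningMap β} (hp : Function.Surjective p) :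
    Function.Surjective (coindMap S.subtype p) := by
  obtain ⟨T, hT, -⟩ := S.exists_isComplement_right 1
  intro ψ
  obtain ⟨χ, hχ⟩ := hp.comp_left (coindVEquiv hT β ψ)
  refine ⟨(coindVEquiv hT α).symm χ, (coindVEquiv hT β).injective (funext fun t => ?_)⟩
  calc p ((coindVEquiv hT α) ((coindVEquiv hT α).symm χ) t) = p (χ t) := by
        rw [LinearEquiv.apply_symm_apply]
    _ = coindVEquiv hT β ψ t := congrFun hχ t

instance [S.FiniteIndex] [Module.Finite k A] : Module.Finite k (coindV S.subtype α) := by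
  obtain ⟨T, hT, -⟩ := S.exists_isComplement_right 1
  have : Finite T := hT.finite_right
  exact .equiv (coindVEquiv hT α).symm

end Subgroup

end Coinduction

namespace VRep

variable {k : Type u} [Field k] {G : Type v} [Group G]

section Class

variable {A B D : Type*} [AddCommGroup A] [Module k A] [Module.Finite k A]
  [AddCommGroup B] [Module k B] [Module.Finite k B]
  [AddCommGroup D] [Module k D] [Module.Finite k D]
  {α : Representation k G A} {β : Representation k G B} {δ : Representation k G D}

/-- The class of a finite dimensional representation. The space may live in any universe, while
those of `FDRep k G` live in that of `k`, so it is replaced by a coordinate space. -/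
def of (α : Representation k G A) : VRep k G :=
  GrothendieckGroup.mk FDRep.SES (FDRep.of
    ((Module.finBasis k A).equivFun.conjRingEquiv.toMonoidHom.comp α))

theorem of_eq_add_of_exact (i : α.IntertwiningMap β) (p : β.IntertwiningMap δ)
    (hi : Function.Injective i) (hip : Function.Exact i p) (hp : Function.Surjective p) :
    of β = of α + of δ := by
  let a := (Module.finBasis k A).equivFun
  let b := (Module.finBasis k B).equivFun
  let d := (Module.finBasis k D).equivFun
  refine GrothendieckGroup.mk_ses ⟨b.toLinearMap ∘ₗ i.toLinearMap ∘ₗ a.symm.toLinearMap,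
    d.toLinearMap ∘ₗ p.toLinearMap ∘ₗ b.symm.toLinearMap, fun g v => ?_, fun g v => ?_,
    b.injective.comp (hi.comp a.symm.injective), fun v => ?_,
    d.surjective.comp (hp.comp b.symm.surjective)⟩
  · change b (i (a.symm (a (α g (a.symm v))))) = b (β g (b.symm (b (i (a.symm v)))))
    rw [a.symm_apply_apply, b.symm_apply_apply, i.isIntertwining]
  · change d (p (b.symm (b (β g (b.symm v))))) = d (δ g (d.symm (d (p (b.symm v)))))
    rw [b.symm_apply_apply, d.symm_apply_apply, p.isIntertwining]
  · change d (p (b.symm v)) = 0 ↔ ∃ w, b (i (a.symm w)) = v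
    calc d (p (b.symm v)) = 0 ↔ ∃ y, i y = b.symm v := by
          rw [d.map_eq_zero_iff, hip, Set.mem_range]
      _ ↔ ∃ w, i (a.symm w) = b.symm v := a.symm.surjective.exists
      _ ↔ ∃ w, b (i (a.symm w)) = v := exists_congr fun _ => b.eq_symm_apply

theorem of_eq_zero [Subsingleton A] (α : Representation k G A) : of α = 0 := by
  have h := of_eq_add_of_exact (.id α) (.id α) Function.injective_id
    (fun a => ⟨fun _ => ⟨a, rfl⟩, fun _ => Subsingleton.elim _ _⟩) Function.surjective_id
  exact left_eq_add.1 h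

theorem of_congr (e : α.Equiv β) : of α = of β := by
  have h := of_eq_add_of_exact (0 : (1 : Representation k G PUnit).IntertwiningMap α)
    e.toIntertwiningMap (fun _ _ _ => rfl)
    (fun a => ⟨fun ha => ⟨0, (e.injective (ha.trans (map_zero e).symm)).symm⟩, by
      rintro ⟨_, rfl⟩
      exact map_zero e⟩) e.surjective
  rw [h, of_eq_zero, zero_add]

theorem mk_eq_of (V : FDRep k G) : GrothendieckGroup.mk FDRep.SES V = of V.ρ := by
  let e := (Module.finBasis k V).equivFun
  let Z : FDRep k G := FDRep.of (1 : Representation k G PUnit.{u + 1})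
  have hZ : GrothendieckGroup.mk FDRep.SES Z = 0 :=
    left_eq_add.1 (GrothendieckGroup.mk_ses ⟨LinearMap.id, LinearMap.id, fun _ _ => rfl,
      fun _ _ => rfl, fun _ _ _ => rfl, fun z => ⟨fun _ => ⟨z, rfl⟩, fun _ => rfl⟩,
      fun z => ⟨z, rfl⟩⟩)
  have h : of V.ρ = GrothendieckGroup.mk FDRep.SES V + GrothendieckGroup.mk FDRep.SES Z :=
    GrothendieckGroup.mk_ses ⟨e.toLinearMap, 0,
      fun g v => congrArg (fun w => e (V.ρ g w)) (e.symm_apply_apply v).symm, fun _ _ => rfl,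
      e.injective, fun v => ⟨fun _ => e.surjective v, fun _ => rfl⟩, fun z => ⟨0, rfl⟩⟩
  rw [h, hZ, add_zero]

end Class

section Sum

variable {ι : Type*} [Fintype ι] {A : Type*} [AddCommGroup A] [Module k A] [Module.Finite k A]
  {M : ι → Type*} [∀ i, AddCommGroup (M i)] [∀ i, Module k (M i)] [∀ i, Module.Finite k (M i)]
  {α : Representation k G A} {μ : ∀ i, Representation k G (M i)}

theorem of_eq_sum (p : ∀ i, α.IntertwiningMap (μ i))
    (hp : Function.Bijective fun a i => p i a) : of α = ∑ i, of (μ i) := by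
  revert A M
  refine Fintype.induction_empty_option (P := fun ι [Fintype ι] => ∀ {A : Type _} [AddCommGroup A]
    [Module k A] [Module.Finite k A] {M : ι → Type _} [∀ i, AddCommGroup (M i)]
    [∀ i, Module k (M i)] [∀ i, Module.Finite k (M i)] {α : Representation k G A}
    {μ : ∀ i, Representation k G (M i)} (p : ∀ i, α.IntertwiningMap (μ i)),
    Function.Bijective (fun a i => p i a) → of α = ∑ i, of (μ i)) ?_ ?_ ?_ ι
  · intro ι ι' _ e ih A _ _ _ M _ _ _ α μ p hp
    let _ := Fintype.ofEquiv ι' e.symm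
    rw [← e.sum_comp, ih fun i => p (e i)]
    exact (Equiv.piCongrLeft M e).symm.bijective.comp hp
  · intro A _ _ _ M _ _ _ α μ p hp
    have : Subsingleton A := hp.injective.subsingleton
    rw [of_eq_zero, Finset.univ_eq_empty, Finset.sum_empty]
  · intro ι _ ih A _ _ _ M _ _ _ α μ p hp
    let K := (p none).ker
    let incl : K.toRepresentation.IntertwiningMap α := ⟨K.toSubmodule.subtype, fun _ => rfl⟩
    have hK : of α = of K.toRepresentation + of (μ none) :=
      of_eq_add_of_exact incl (p none) Subtype.val_injective
        (fun a => Subtype.range_coe.symm ▸ Iff.rfl) fun m => by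
          classical
          obtain ⟨a, ha⟩ := hp.surjective (Pi.single none m)
          exact ⟨a, (congrFun ha none).trans (Pi.single_eq_same _ _)⟩
    rw [hK, add_comm, Fintype.sum_option, ih fun i => (p (some i)).comp incl]
    refine ⟨fun a b h => Subtype.ext (hp.injective (funext fun i => ?_)), fun m => ?_⟩
    · cases i with
      | none => exact a.2.trans b.2.symm
      | some i => exact congrFun h i
    · obtain ⟨a, ha⟩ := hp.surjective (Option.rec 0 m)
      exact ⟨⟨a, congrFun ha none⟩, funext fun i => congrFun ha (some i)⟩

end Sum

section Tensor

variable {G₁ G₂ : Type v} [Group G₁] [Group G₂] (φ₁ : G →* G₁) (φ₂ : G →* G₂)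

/-- The tensor product of representations of `G₁` and `G₂`, both pulled back to `G`. -/
abbrev resTensor (A : FDRep k G₁) (B : FDRep k G₂) : FDRep k G :=
  FDRep.of (Representation.tprod (A.ρ.comp φ₁) (B.ρ.comp φ₂))

theorem resTensor_ses_right (A : FDRep k G₁) {B B' B'' : FDRep k G₂} (h : FDRep.SES B B' B'') :
    FDRep.SES (resTensor φ₁ φ₂ A B) (resTensor φ₁ φ₂ A B') (resTensor φ₁ φ₂ A B'') := by
  obtain ⟨i, p, hi, hp, i_inj, hip, p_surj⟩ := h
  have hi' (g : G) : LinearMap.lTensor A i ∘ₗ (resTensor φ₁ φ₂ A B).ρ g =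
      (resTensor φ₁ φ₂ A B').ρ g ∘ₗ LinearMap.lTensor A i :=
    TensorProduct.ext' fun a b => congrArg (A.ρ (φ₁ g) a ⊗ₜ[k] ·) (hi (φ₂ g) b)
  have hp' (g : G) : LinearMap.lTensor A p ∘ₗ (resTensor φ₁ φ₂ A B').ρ g =
      (resTensor φ₁ φ₂ A B'').ρ g ∘ₗ LinearMap.lTensor A p :=
    TensorProduct.ext' fun a b => congrArg (A.ρ (φ₁ g) a ⊗ₜ[k] ·) (hp (φ₂ g) b)
  exact ⟨LinearMap.lTensor A i, LinearMap.lTensor A p, fun g => LinearMap.congr_fun (hi' g),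
    fun g => LinearMap.congr_fun (hp' g), Module.Flat.lTensor_preserves_injective_linearMap _ i_inj,
    lTensor_exact _ hip p_surj, LinearMap.lTensor_surjective _ p_surj⟩

theorem resTensor_ses_left {A A' A'' : FDRep k G₁} (h : FDRep.SES A A' A'') (B : FDRep k G₂) :
    FDRep.SES (resTensor φ₁ φ₂ A B) (resTensor φ₁ φ₂ A' B) (resTensor φ₁ φ₂ A'' B) := by
  obtain ⟨i, p, hi, hp, i_inj, hip, p_surj⟩ := h
  have hi' (g : G) : LinearMap.rTensor B i ∘ₗ (resTensor φ₁ φ₂ A B).ρ g =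
      (resTensor φ₁ φ₂ A' B).ρ g ∘ₗ LinearMap.rTensor B i :=
    TensorProduct.ext' fun a b => congrArg (· ⊗ₜ[k] B.ρ (φ₂ g) b) (hi (φ₁ g) a)
  have hp' (g : G) : LinearMap.rTensor B p ∘ₗ (resTensor φ₁ φ₂ A' B).ρ g =
      (resTensor φ₁ φ₂ A'' B).ρ g ∘ₗ LinearMap.rTensor B p :=
    TensorProduct.ext' fun a b => congrArg (· ⊗ₜ[k] B.ρ (φ₂ g) b) (hp (φ₁ g) a)
  exact ⟨LinearMap.rTensor B i, LinearMap.rTensor B p, fun g => LinearMap.congr_fun (hi' g),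
    fun g => LinearMap.congr_fun (hp' g), Module.Flat.rTensor_preserves_injective_linearMap _ i_inj,
    rTensor_exact _ hip p_surj, LinearMap.rTensor_surjective _ p_surj⟩

/-- The biadditive extension of `resTensor` to virtual representations. -/
def tensorRes : VRep k G₁ →+ VRep k G₂ →+ VRep k G :=
  GrothendieckGroup.lift
    (fun A => GrothendieckGroup.lift (fun B => GrothendieckGroup.mk FDRep.SES (resTensor φ₁ φ₂ A B))
      fun _ _ _ h => GrothendieckGroup.mk_ses (resTensor_ses_right φ₁ φ₂ A h))
    fun _ _ _ h => GrothendieckGroup.hom_ext fun B => by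
      simpa only [AddMonoidHom.add_apply, GrothendieckGroup.lift_mk] using
        GrothendieckGroup.mk_ses (resTensor_ses_left φ₁ φ₂ h B)

theorem tensorRes_mk (A : FDRep k G₁) (B : FDRep k G₂) :
    tensorRes φ₁ φ₂ (GrothendieckGroup.mk FDRep.SES A) (GrothendieckGroup.mk FDRep.SES B) =
      GrothendieckGroup.mk FDRep.SES (resTensor φ₁ φ₂ A B) := by
  simp only [tensorRes, GrothendieckGroup.lift_mk]

end Tensor

section Coinduction

variable (S : Subgroup G) [S.FiniteIndex]

/-- Coinduction of virtual representations from a subgroup of finite index, where it agrees with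
induction. -/
def coindHom : VRep k S →+ VRep k G :=
  GrothendieckGroup.lift (fun A => of (Representation.coind S.subtype A.ρ))
    fun A B D ⟨i, p, hi, hp, i_inj, hip, p_surj⟩ => by
      let i' : Representation.IntertwiningMap A.ρ B.ρ := ⟨i, fun g => LinearMap.ext (hi g)⟩
      let p' : Representation.IntertwiningMap B.ρ D.ρ := ⟨p, fun g => LinearMap.ext (hp g)⟩
      exact of_eq_add_of_exact (Representation.coindMap S.subtype i')
        (Representation.coindMap S.subtype p') (coindMap_injective S.subtype i_inj)
        (coindMap_exact S.subtype i_inj hip) (coindMap_surjective p_surj)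

theorem coindHom_mk (A : FDRep k S) :
    coindHom S (GrothendieckGroup.mk FDRep.SES A) = of (Representation.coind S.subtype A.ρ) :=
  GrothendieckGroup.lift_mk _ _ _

end Coinduction

end VRep

section Orbits

variable {G X : Type*} [Group G] [MulAction G X]

instance finiteIndex_stabilizer [Finite X] (y : X) : (MulAction.stabilizer G y).FiniteIndex where
  index_ne_zero := by
    rw [MulAction.index_stabilizer]
    exact ((Set.ncard_pos (Set.toFinite _)).2 ⟨y, MulAction.mem_orbit_self y⟩).ne'

theorem exists_smul_eq_orbitRel_out (a : X) :
    ∃ g : G, g • a = (Quotient.mk'' a : MulAction.orbitRel.Quotient G X).out :=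
  MulAction.orbitRel_apply.1 (Quotient.mk_out (s := MulAction.orbitRel G X) a)

theorem eq_mk_of_smul_eq_orbitRel_out {ω : MulAction.orbitRel.Quotient G X} {g : G} {a : X}
    (h : g • a = ω.out) : ω = Quotient.mk'' a :=
  ω.out_eq'.symm.trans (Quotient.sound' (MulAction.orbitRel_apply.2 ⟨g, h⟩))

end Orbits

/-- A `G`-equivariant bundle of `k`-vector spaces over a `G`-set. As in `IntervalRep`, the target
of the action of `g` on the fibre at `a` is the fibre at any `b` with a proof of `g • a = b`, to
avoid transport along equalities of points. -/
structure EquivariantBundle (k : Type*) [Ring k] (G : Type*) [Group G] (X : Type*)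
    [MulAction G X] where
  fibre : X → Type*
  [addCommGroup : ∀ a, AddCommGroup (fibre a)]
  [module : ∀ a, Module k (fibre a)]
  act : ∀ (g : G) {a b : X}, g • a = b → fibre a →ₗ[k] fibre b
  act_one : ∀ {a : X} (h : (1 : G) • a = a) (v : fibre a), act 1 h v = v
  act_mul : ∀ (g g' : G) {a b c : X} (h' : g' • a = b) (h : g • b = c) (hm : (g * g') • a = c)
    (v : fibre a), act g h (act g' h' v) = act (g * g') hm v

namespace EquivariantBundle

attribute [instance] addCommGroup module

variable {k G X : Type*} [Ring k] [Group G] [MulAction G X] (E : EquivariantBundle k G X)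

theorem act_congr {g g' : G} {a b : X} (h : g • a = b) (h' : g' • a = b) (e : g = g') :
    E.act g h = E.act g' h' := by
  subst e
  rfl

theorem act_inv_act (g : G) {a b : X} (h : g • a = b) (h' : g⁻¹ • b = a) (v : E.fibre a) :
    E.act g⁻¹ h' (E.act g h v) = v := by
  rw [E.act_mul g⁻¹ g h h' (by rw [inv_mul_cancel, one_smul]),
    E.act_congr _ (one_smul G a) (inv_mul_cancel g), E.act_one]

theorem act_section (m : ∀ a, E.fibre a) {g : G} {a a' b : X} (h : g • a = b) (h' : g • a' = b) :
    E.act g h (m a) = E.act g h' (m a') := by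
  obtain rfl : a = a' := MulAction.injective g (h.trans h'.symm)
  rfl

/-- The representation of `G` on the sections of a bundle, `(g m)(b) = g (m (g⁻¹ b))`. -/
def sections : Representation k G (∀ a, E.fibre a) where
  toFun g := LinearMap.pi fun b => E.act g (smul_inv_smul g b) ∘ₗ LinearMap.proj (g⁻¹ • b)
  map_one' := LinearMap.ext fun m => funext fun b =>
    (E.act_section m _ (one_smul G b)).trans (E.act_one _ _)
  map_mul' g g' := LinearMap.ext fun m => funext fun b => by
    change E.act (g * g') _ (m ((g * g')⁻¹ • b)) = E.act g _ (E.act g' _ (m (g'⁻¹ • g⁻¹ • b)))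
    rw [E.act_mul g g' _ _ (by rw [mul_smul, smul_inv_smul, smul_inv_smul])]
    exact E.act_section m _ _

theorem sections_apply (m : ∀ a, E.fibre a) {g : G} {a b : X} (h : g • a = b) :
    E.sections g m b = E.act g h (m a) :=
  E.act_section m _ h

theorem sections_single [DecidableEq X] (g : G) (a : X) (v : E.fibre a) :
    E.sections g (Pi.single a v) = Pi.single (g • a) (E.act g rfl v) := by
  funext b
  obtain ⟨c, rfl⟩ := MulAction.surjective g b
  rw [E.sections_apply _ rfl]
  by_cases hc : c = a
  · subst hc
    rw [Pi.single_eq_same, Pi.single_eq_same]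
  · rw [Pi.single_eq_of_ne hc, Pi.single_eq_of_ne ((MulAction.injective g).ne hc), map_zero]

/-- The representation of the stabilizer of `y` on the fibre at `y`. -/
def fibreRep (y : X) : Representation k (MulAction.stabilizer G y) (E.fibre y) where
  toFun g := E.act g.1 g.2
  map_one' := LinearMap.ext fun v => E.act_one _ v
  map_mul' g h := LinearMap.ext fun v => (E.act_mul g.1 h.1 h.2 g.2 (g * h).2 v).symm

/-- A section `m` gives the equivariant function `g ↦ g (m (g⁻¹ y))` on `G`. -/
def toCoind (y : X) : E.sections.IntertwiningMap
    (Representation.coind (MulAction.stabilizer G y).subtype (E.fibreRep y)) where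
  toFun m := ⟨fun g => E.act g (smul_inv_smul g y) (m (g⁻¹ • y)), fun s g => by
    have hs : (s * g)⁻¹ • y = g⁻¹ • y := by rw [mul_inv_rev, mul_smul, inv_smul_eq_iff.2 s.2.symm]
    exact (E.act_section m _ ((congrArg _ hs).symm.trans (smul_inv_smul _ _))).trans
      (E.act_mul s.1 g _ s.2 _ _).symm⟩
  map_add' m m' := Subtype.ext (funext fun g => map_add (E.act g _) _ _)
  map_smul' c m := Subtype.ext (funext fun g => map_smul (E.act g _) c _)
  isIntertwining' g := LinearMap.ext fun m => Subtype.ext <| funext fun g' => by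
    change E.act g' _ (E.sections g m (g'⁻¹ • y)) = E.act (g' * g) _ (m ((g' * g)⁻¹ • y))
    rw [E.sections_apply m (a := (g' * g)⁻¹ • y) (by rw [mul_inv_rev, mul_smul, smul_inv_smul]),
      E.act_mul]

theorem toCoind_apply (y : X) (m : ∀ a, E.fibre a) {g : G} {a : X} (h : g • a = y) :
    (E.toCoind y m).1 g = E.act g h (m a) :=
  E.act_section m _ h

theorem toCoind_bijective : Function.Bijective
    fun m (ω : MulAction.orbitRel.Quotient G X) => E.toCoind ω.out m := by
  choose γ hγ using exists_smul_eq_orbitRel_out (G := G) (X := X)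
  have hγ' (a : X) : (γ a)⁻¹ • (Quotient.mk'' a : MulAction.orbitRel.Quotient G X).out = a :=
    inv_smul_eq_iff.2 (hγ a).symm
  constructor
  · intro m m' h
    funext a
    have ha : E.act (γ a) (hγ a) (m a) = E.act (γ a) (hγ a) (m' a) := by
      rw [← toCoind_apply, ← toCoind_apply]
      exact congrArg (fun ψ => ψ.1 (γ a)) (congrFun h (Quotient.mk'' a))
    rw [← E.act_inv_act (γ a) (hγ a) (hγ' a) (m a), ha, E.act_inv_act]
  · intro ψ
    let m (a : X) : E.fibre a := E.act (γ a)⁻¹ (hγ' a) ((ψ (Quotient.mk'' a)).1 (γ a))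
    have hm {ω : MulAction.orbitRel.Quotient G X} {g : G} {a : X} (h : g • a = ω.out) :
        E.act g h (m a) = (ψ ω).1 g := by
      obtain rfl := eq_mk_of_smul_eq_orbitRel_out h
      let s : MulAction.stabilizer G (Quotient.mk'' a : MulAction.orbitRel.Quotient G X).out :=
        ⟨g * (γ a)⁻¹, by rw [MulAction.mem_stabilizer_iff, mul_smul, hγ', h]⟩
      calc E.act g h (m a) = E.fibreRep _ s ((ψ (Quotient.mk'' a)).1 (γ a)) :=
            E.act_mul g (γ a)⁻¹ _ h s.2 _
        _ = (ψ (Quotient.mk'' a)).1 (s.1 * γ a) := ((ψ (Quotient.mk'' a)).2 s (γ a)).symm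
        _ = (ψ (Quotient.mk'' a)).1 g := by rw [inv_mul_cancel_right]
    exact ⟨m, funext fun ω => Subtype.ext <| funext fun g => hm (smul_inv_smul g ω.out)⟩

end EquivariantBundle

namespace VRep

theorem of_sections {k : Type u} [Field k] {G : Type v} [Group G] {X : Type*} [MulAction G X]
    [Finite X] [Fintype (MulAction.orbitRel.Quotient G X)] (E : EquivariantBundle k G X)
    [∀ a, Module.Finite k (E.fibre a)] :
    of E.sections = ∑ ω : MulAction.orbitRel.Quotient G X,
      of (Representation.coind (MulAction.stabilizer G ω.out).subtype (E.fibreRep ω.out)) :=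
  of_eq_sum (fun ω => E.toCoind ω.out) E.toCoind_bijective

end VRep

namespace IntervalRep

variable {k : Type u} [Field k] {W : Type v} [Group W] {P : Type u} [PartialOrder P]
  [MulAction W P]

section Interval

variable [CovariantClass W P HSMul.hSMul LE.le] {x z : P}

instance stabMulActionIcc : MulAction (stab W x z) (Set.Icc x z) where
  smul σ y := ⟨σ.1 • y.1, mem_Icc_smul σ.1 σ.2.1 σ.2.2 y⟩
  one_smul y := Subtype.ext (one_smul W y.1)
  mul_smul σ τ y := Subtype.ext (mul_smul σ.1 τ.1 y.1)

/-- The inclusion of the common stabilizer of `x`, `y` and `z` in that of `x` and `y`. -/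
def stabLeft (y : Set.Icc x z) : MulAction.stabilizer (stab W x z) y →* stab W x y.1 where
  toFun σ := ⟨σ.1.1, σ.1.2.1, congrArg Subtype.val σ.2⟩
  map_one' := rfl
  map_mul' _ _ := rfl

/-- The inclusion of the common stabilizer of `x`, `y` and `z` in that of `y` and `z`. -/
def stabRight (y : Set.Icc x z) : MulAction.stabilizer (stab W x z) y →* stab W y.1 z where
  toFun σ := ⟨σ.1.1, congrArg Subtype.val σ.2, σ.1.2.2⟩
  map_one' := rfl
  map_mul' _ _ := rfl

/-- The bundle over the interval `[x, z]` whose sections are the component at `x ≤ z` of `U ⊗ V`. -/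
abbrev tensorBundle (U V : IntervalRep k W P) (x z : P) :
    EquivariantBundle k (stab W x z) (Set.Icc x z) where
  fibre y := U.V x y y.2.1 ⊗[k] V.V y z y.2.2
  act σ a b hab := TensorProduct.map
    (U.act σ.1 σ.2.1 (congrArg Subtype.val hab) a.2.1 b.2.1)
    (V.act σ.1 (congrArg Subtype.val hab) σ.2.2 a.2.2 b.2.2)
  act_one _ := LinearMap.congr_fun <|
    (congrArg₂ TensorProduct.map (LinearMap.ext (U.act_one _ _ _))
      (LinearMap.ext (V.act_one _ _ _))).trans TensorProduct.map_id
  act_mul _ _ _ _ _ _ _ _ v := by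
    rw [← LinearMap.comp_apply, ← TensorProduct.map_comp]
    exact LinearMap.congr_fun (congrArg₂ TensorProduct.map
      (LinearMap.ext (U.act_mul _ _ _ _ _ _ _ _ _ _ _))
      (LinearMap.ext (V.act_mul _ _ _ _ _ _ _ _ _ _ _))) v

end Interval

variable [LocallyFiniteOrder P] [CovariantClass W P HSMul.hSMul LE.le]

instance (x z : P) : Fintype (MulAction.orbitRel.Quotient (stab W x z) (Set.Icc x z)) :=
  Fintype.ofFinite _

open Classical in
/-- The component of `U ⊗ V` at `x ≤ z`, a direct sum over `[x, z]`, as a space of sections. -/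
def tensorRepEquiv (U V : IntervalRep k W P) (x z : P) (h : x ≤ z) :
    Representation.Equiv ((tensor U V).rep x z h).ρ (tensorBundle U V x z).sections :=
  .mk (DirectSum.linearEquivFunOnFintype k (Set.Icc x z) (tensorBundle U V x z).fibre) fun σ =>
    tensor_hom_ext fun y u v =>
      calc DirectSum.linearEquivFunOnFintype k _ (tensorBundle U V x z).fibre
            (((tensor U V).rep x z h).ρ σ (DirectSum.lof k _ _ y (u ⊗ₜ v)))
        _ = DirectSum.linearEquivFunOnFintype k _ (tensorBundle U V x z).fibre
            (DirectSum.lof k _ _ (σ • y) ((tensorBundle U V x z).act σ rfl (u ⊗ₜ v))) :=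
          congrArg _ (tensor_act_lof U V σ.1 σ.2.1 σ.2.2 h h y (σ • y) rfl u v)
        _ = (tensorBundle U V x z).sections σ (Pi.single y (u ⊗ₜ v)) :=
          ((tensorBundle U V x z).sections_single σ y (u ⊗ₜ v)).symm

theorem mk_rep_tensor (U V : IntervalRep k W P) (x z : P) (h : x ≤ z) :
    GrothendieckGroup.mk FDRep.SES ((tensor U V).rep x z h) =
      ∑ ω : MulAction.orbitRel.Quotient (stab W x z) (Set.Icc x z),
        VRep.coindHom (MulAction.stabilizer _ ω.out)
          (VRep.tensorRes (stabLeft ω.out) (stabRight ω.out)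
            (GrothendieckGroup.mk FDRep.SES (U.rep x ω.out.1 ω.out.2.1))
            (GrothendieckGroup.mk FDRep.SES (V.rep ω.out.1 z ω.out.2.2))) := by
  simp_rw [VRep.tensorRes_mk, VRep.coindHom_mk]
  rw [VRep.mk_eq_of, VRep.of_congr (tensorRepEquiv U V x z h), VRep.of_sections]
  rfl

end IntervalRep

theorem EquivIncidenceAlgebra.comp_mul {k : Type u} [Field k] {W : Type v} [Group W]
    {P : Type u} [PartialOrder P] [MulAction W P] [LocallyFiniteOrder P]
    [CovariantClass W P HSMul.hSMul LE.le] (f g : EquivIncidenceAlgebra k W P) (x z : P)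
    (h : x ≤ z) :
    comp x z h (f * g) =
      ∑ ω : MulAction.orbitRel.Quotient (IntervalRep.stab W x z) (Set.Icc x z),
        VRep.coindHom (MulAction.stabilizer _ ω.out)
          (VRep.tensorRes (IntervalRep.stabLeft ω.out) (IntervalRep.stabRight ω.out)
            (comp x ω.out.1 ω.out.2.1 f) (comp ω.out.1 z ω.out.2.2 g)) := by
  let Φ : EquivIncidenceAlgebra k W P →+ EquivIncidenceAlgebra k W P →+
      VRep k (IntervalRep.stab W x z) :=
    ∑ ω : MulAction.orbitRel.Quotient (IntervalRep.stab W x z) (Set.Icc x z),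
      ((VRep.tensorRes (IntervalRep.stabLeft ω.out) (IntervalRep.stabRight ω.out)).compl₂
        (comp ω.out.1 z ω.out.2.2) |>.comp (comp x ω.out.1 ω.out.2.1)).compr₂
          (VRep.coindHom (MulAction.stabilizer _ ω.out))
  have mul_eq : (mulHom (k := k) (W := W) (P := P)).compr₂ (comp x z h) = Φ :=
    GrothendieckGroup.hom_ext fun U => GrothendieckGroup.hom_ext fun V => by
      change comp x z h (mk U * mk V) = _
      simp [Φ, mk_mul_mk, comp, IntervalRep.mk_rep_tensor]
  exact (DFunLike.congr_fun (DFunLike.congr_fun mul_eq f) g).trans (by simp [Φ])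

open Finset.HasAntidiagonal in
theorem sum_antidiagonal_reflect {A B C : Type*} [AddCommMonoid A] [AddCommMonoid B]
    [AddCommMonoid C] (Φ : A →+ B →+ C) {r s : ℕ} {a : ℕ → A} {b : ℕ → B}
    (ha : ∀ i, r < i → a i = 0) (hb : ∀ j, s < j → b j = 0) (n : ℕ) :
    ∑ p ∈ antidiagonal n, Φ (if p.1 ≤ r then a (r - p.1) else 0)
        (if p.2 ≤ s then b (s - p.2) else 0) =
      if n ≤ r + s then ∑ p ∈ antidiagonal (r + s - n), Φ (a p.1) (b p.2) else 0 := by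
  have hl : ∑ p ∈ antidiagonal n, Φ (if p.1 ≤ r then a (r - p.1) else 0)
        (if p.2 ≤ s then b (s - p.2) else 0) =
      ∑ p ∈ antidiagonal n with p.1 ≤ r ∧ p.2 ≤ s, Φ (a (r - p.1)) (b (s - p.2)) := by
    rw [Finset.sum_filter]
    refine Finset.sum_congr rfl fun p _ => ?_
    by_cases h₁ : p.1 ≤ r <;> by_cases h₂ : p.2 ≤ s <;> simp [h₁, h₂]
  have hr (m : ℕ) : ∑ p ∈ antidiagonal m, Φ (a p.1) (b p.2) =
      ∑ p ∈ antidiagonal m with p.1 ≤ r ∧ p.2 ≤ s, Φ (a p.1) (b p.2) := by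
    refine (Finset.sum_filter_of_ne fun p _ hp => ?_).symm
    contrapose! hp
    rcases lt_or_ge r p.1 with h | h
    · rw [ha _ h, map_zero, AddMonoidHom.zero_apply]
    · rw [hb _ (hp h), map_zero]
  rw [hl]
  split_ifs with hn
  · rw [hr]
    refine Finset.sum_nbij' (fun p => (r - p.1, s - p.2)) (fun p => (r - p.1, s - p.2))
      ?_ ?_ ?_ ?_ fun _ _ => rfl
    all_goals
      rintro ⟨i, j⟩ hp
      simp only [Finset.mem_filter, mem_antidiagonal, Prod.mk.injEq] at hp ⊢
      omega
  · rw [Finset.filter_false_of_mem fun p hp => ?_, Finset.sum_empty]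
    rw [mem_antidiagonal] at hp
    omega

namespace EquivKLS

variable {k : Type u} [Field k] {W : Type v} [Group W] {P : Type u} [PartialOrder P]
  [LocallyFiniteOrder P] [MulAction W P] [CovariantClass W P HSMul.hSMul LE.le]
  {ρ : WeakRankFunction W P} {f f' g g' : PowerSeries (EquivIncidenceAlgebra k W P)}

open Finset.HasAntidiagonal in
theorem coeffAt_mul (f g : PowerSeries (EquivIncidenceAlgebra k W P)) (x z : P) (h : x ≤ z)
    (n : ℕ) :
    coeffAt (f * g) x z h n =
      ∑ ω : MulAction.orbitRel.Quotient (IntervalRep.stab W x z) (Set.Icc x z),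
        ∑ p ∈ antidiagonal n,
          (VRep.tensorRes (IntervalRep.stabLeft ω.out) (IntervalRep.stabRight ω.out)).compr₂
            (VRep.coindHom (MulAction.stabilizer _ ω.out))
            (coeffAt f x ω.out.1 ω.out.2.1 p.1) (coeffAt g ω.out.1 z ω.out.2.2 p.2) := by
  rw [coeffAt, PowerSeries.coeff_mul, map_sum, Finset.sum_comm]
  exact Finset.sum_congr rfl fun p _ => EquivIncidenceAlgebra.comp_mul _ _ x z h

theorem MemIHalf.memI (hf : MemIHalf ρ f) : MemI ρ f := by
  intro x y h n hn
  rcases h.lt_or_eq with hlt | rfl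
  · exact hf.1 x y hlt n (by omega)
  · rw [hf.2, coeffAt, PowerSeries.coeff_one, if_neg (by omega), map_zero]

theorem IsBar.memI (h : IsBar ρ f f') : MemI ρ f' := fun x y hxy n hn => by
  rw [h, barCoeffAt, if_neg hn.not_ge]

theorem IsBar.symm (h : IsBar ρ f f') (hf : MemI ρ f) : IsBar ρ f' f := fun x y hxy n => by
  rw [barCoeffAt]
  split_ifs with hn
  · rw [h, barCoeffAt, if_pos (Nat.sub_le _ _), Nat.sub_sub_self hn]
  · exact hf x y hxy n (not_le.1 hn)

theorem IsBar.mul (hf : MemI ρ f) (hg : MemI ρ g) (hff' : IsBar ρ f f') (hgg' : IsBar ρ g g') :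
    IsBar ρ (f * g) (f' * g') := by
  intro x z h n
  rw [barCoeffAt, coeffAt_mul, coeffAt_mul, ← Finset.sum_const_zero, ← Finset.sum_ite_irrel]
  refine Finset.sum_congr rfl fun ω _ => ?_
  simp only [hff' x _ _ _, hgg' _ z _ _, barCoeffAt]
  rw [← ρ.add ω.out.2.1 ω.out.2.2]
  exact sum_antidiagonal_reflect _ (hf x ω.out.1 ω.out.2.1) (hg ω.out.1 z ω.out.2.2) n

end EquivKLS

end

theorem mainTheorem4_general {k : Type u} [Field k] {W : Type v} [Group W]
    {P : Type u} [PartialOrder P] [LocallyFiniteOrder P] [MulAction W P]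
    [CovariantClass W P HSMul.hSMul LE.le] (ρ : WeakRankFunction W P)
    (κ f g : PowerSeries (EquivIncidenceAlgebra k W P))
    (hf : EquivKLS.MemI ρ f) (hfκ : EquivKLS.IsBar ρ f (κ * f))
    (hg : EquivKLS.MemI ρ g) (hgκ : EquivKLS.IsBar ρ g (g * κ)) :
    EquivKLS.MemI ρ (g * κ * f) ∧ EquivKLS.IsBar ρ (g * κ * f) (g * κ * f) := by
  have h : EquivKLS.IsBar ρ (g * (κ * f)) (g * κ * f) :=
    EquivKLS.IsBar.mul hg hfκ.memI hgκ (hfκ.symm hf)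
  rw [← mul_assoc] at h
  exact ⟨h.memI, h⟩

theorem mainTheorem4 {k : Type u} [Field k] {W : Type v} [Group W] [Finite W]
    {P : Type u} [PartialOrder P] [LocallyFiniteOrder P] [MulAction W P]
    [CovariantClass W P HSMul.hSMul LE.le] (ρ : WeakRankFunction W P)
    (κ f g : PowerSeries (EquivIncidenceAlgebra k W P))
    (hκ : EquivKLS.IsPKernel ρ κ) (hf : EquivKLS.IsRightKLS ρ κ f)
    (hg : EquivKLS.IsLeftKLS ρ κ g) :
    EquivKLS.MemI ρ (g * κ * f) ∧ EquivKLS.IsBar ρ (g * κ * f) (g * κ * f) :=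
  mainTheorem4_general ρ κ f g hf.1.memI hf.2 hg.1.memI hg.2
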